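/- Let $\mathfrak S_n$ be the set of permutations (rankings) of $\{1,\dots,n\}$ and let $d_\tau(\sigma,\sigma')=\sum_{i<j}\mathbb I\{(\sigma(i)-\sigma(j))(\sigma'(i)-\sigma'(j))<0\}$ be the Kendall $\tau$ distance. For a finite measure $Q$ on $\mathfrak S_n$ put $L_Q(\sigma)=\int d_\tau(\sigma',\sigma)\,Q(d\sigma')$; a Kemeny median of $Q$ is a minimizer of $L_Q$. Let $\mathcal T$ be the set of strictly stochastically transitive probability distributions $Q$ on $\mathfrak S_n$: with $p_{i,j}=Q\{\Sigma(i)<\Sigma(j)\}$, one has $p_{i,j}\neq 1/2$ for all $i<j$, and $p_{i,j}\ge 1/2$, $p_{j,k}\ge 1/2$ imply $p_{i,k}\ge 1/2$ for all distinct $i,j,k$; the Kemeny median of $Q\in\mathcal T$ is unique. Let $\mathcal X\subset\mathbb R^d$ be compact (for instance $[0,1]^d$), let $\|\cdot\|$ be any norm on $\mathbb R^d$, and let $(X,\Sigma)$ be a random pair in $\mathcal X\times\mathfrak S_n$; write $\mu$ for the law of $X$, $P_x$ for the conditional law of $\Sigma$ given $X=x$, and $p_{i,j}(x)=P_x\{\Sigma(i)<\Sigma(j)\}$.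 The risk of a measurable $s:\mathcal X\to\mathfrak S_n$ is $\mathcal R(s)=\int L_{P_x}(s(x))\,\mu(dx)$, and $\mathcal R^*$ is its infimum over all measurable $s$. Let $(X_1,\Sigma_1),(X_2,\Sigma_2),\dots$ be i.i.d. copies of $(X,\Sigma)$ and $\mathcal D_N=((X_1,\Sigma_1),\dots,(X_N,\Sigma_N))$. For each $N\ge1$ let $\pi_N$ be an $N$-sample partitioning rule, i.e. a map that sends every sample $D\in(\mathcal X\times\mathfrak S_n)^N$ to a finite partition $\pi_N(D)$ of $\mathcal X$ into Borel cells, such that the relation "$x$ and $x'$ lie in the same cell of $\pi_N(D)$" is jointly measurable in $(D,x,x')$. Let $\mathcal F_N$ be the collection of all partitions $\pi_N(D)$, and let $\Delta_N(\mathcal F_N)$ be the $N$-th shatter coefficient of the class of all sets that are unions of cells of a partition in $\mathcal F_N$ (the largest number of subsets of $N$ points that can be picked out by sets of this class). Put $\mathcal P_N=\pi_N(\mathcal D_N)$, $\delta_{\mathcal P_N}=\max_{\mathcal C\in\mathcal P_N}\sup_{x,x'\in\mathcal C}\|x-x'\|$ and $\kappa_N=\inf\{\mu(\mathcal C):\mathcal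 C\in\mathcal P_N\}$. For a set $\mathcal C$ let $\widehat P_{\mathcal C}=N_{\mathcal C}^{-1}\sum_{k\le N:\,X_k\in\mathcal C}\delta_{\Sigma_k}$ with $N_{\mathcal C}=\#\{k\le N: X_k\in\mathcal C\}$, and $\widehat P_{\mathcal C}=0$ if $N_{\mathcal C}=0$. Suppose that $P_x\in\mathcal T$ for all $x\in\mathcal X$, that there is $M<\infty$ with $\sum_{i<j}|p_{i,j}(x)-p_{i,j}(x')|\le M\|x-x'\|$ for all $x,x'\in\mathcal X$, and that (i) $\lim_{N\to\infty}\log(\Delta_N(\mathcal F_N))/N=0$; (ii) $\delta_{\mathcal P_N}\to0$ in probability and $1/\kappa_N=o_{\mathbb P}\big(\sqrt{N/\log\Delta_N(\mathcal F_N)}\big)$ as $N\to\infty$. Then any rule $s_N$ that is constant on each cell $\mathcal C$ of $\mathcal P_N$ and equals there, if $\mu(\mathcal C)>0$, a (any) Kemeny median of $\widehat P_{\mathcal C}$ is consistent: $\mathcal R(s_N)\to\mathcal R^*$ in probability as $N\to\infty$. Suppose in addition that $\inf_{x\in\mathcal X}\min_{i<j}|p_{i,j}(x)-1/2|>0$.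 Then any rule $\widetilde s_N$ that is constant on each cell $\mathcal C$ of $\mathcal P_N$ and equals there, if $\mu(\mathcal C)>0$, a pseudo-empirical median $\widetilde\sigma_{\mathcal C}$ is also consistent, where $\widetilde\sigma_{\mathcal C}$ is the Kemeny median of $\widehat P_{\mathcal C}$ if $\widehat P_{\mathcal C}\in\mathcal T$, and otherwise is any permutation that orders the items as the empirical Borda count does, i.e. with $b_i=\sum_{k\le N:\,X_k\in\mathcal C}\Sigma_k(i)$, $(b_i-b_j)(\widetilde\sigma_{\mathcal C}(i)-\widetilde\sigma_{\mathcal C}(j))>0$ for all $i<j$ with $b_i\ne b_j$. -/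

import Mathlib

open MeasureTheory ProbabilityTheory Filter Topology
open scoped ENNReal

noncomputable section

namespace RankingMedian

/-- Rankings of `n` items: `σ i` is the (zero-based) rank of item `i`. -/
abbrev Ranking (n : ℕ) : Type := Equiv.Perm (Fin n)

/-- The symmetric group is finite and carries the discrete σ-algebra. -/
instance instMeasurableSpaceRanking (n : ℕ) : MeasurableSpace (Equiv.Perm (Fin n)) := ⊤

/-- The pairs of items `i < j`. -/
def itemPairs (n : ℕ) : Finset (Fin n × Fin n) :=
  Finset.univ.filter fun p => p.1 < p.2

/-- The Kendall `τ` distance: the number of pairs `i < j` on which the two rankings disagree. -/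
def kendall {n : ℕ} (σ τ : Ranking n) : ℕ :=
  ((itemPairs n).filter fun p =>
    (((σ p.1 : ℕ) : ℤ) - ((σ p.2 : ℕ) : ℤ)) * (((τ p.1 : ℕ) : ℤ) - ((τ p.2 : ℕ) : ℤ)) < 0).card

/-- `L_Q(σ)`: the expected Kendall distance to `σ` of a random ranking of law `Q`. -/
def medianRisk {n : ℕ} (Q : Measure (Ranking n)) (σ : Ranking n) : ℝ :=
  ∫ τ, (kendall τ σ : ℝ) ∂Q

/-- `σ` is a Kemeny median of `Q`: a minimizer of the expected Kendall distance. -/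
def IsKemenyMedian {n : ℕ} (Q : Measure (Ranking n)) (σ : Ranking n) : Prop :=
  ∀ τ : Ranking n, medianRisk Q σ ≤ medianRisk Q τ

/-- The pairwise probability `p_{i,j} = Q{Σ(i) < Σ(j)}`. -/
def pairProb {n : ℕ} (Q : Measure (Ranking n)) (i j : Fin n) : ℝ :=
  Q.real {σ | σ i < σ j}

/-- The class `𝒯` of strictly stochastically transitive probability distributions on rankings
(`p_{i,j}` is considered for distinct items only). -/
structure StrictlyTransitive {n : ℕ} (Q : Measure (Ranking n)) : Prop where
  isProbability : IsProbabilityMeasure Q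
  transitive : ∀ i j k : Fin n, i ≠ j → j ≠ k → i ≠ k →
    1 / 2 ≤ pairProb Q i j → 1 / 2 ≤ pairProb Q j k → 1 / 2 ≤ pairProb Q i k
  strict : ∀ i j : Fin n, i < j → pairProb Q i j ≠ 1 / 2

section Risk

variable {α : Type*} [MeasurableSpace α] {n : ℕ}

/-- `R(s) = E_{X ∼ μ}[L_{P_X}(s(X))]`, the ranking median regression risk of `s`, where `μ` is the
law of the input `X` and `P x` is the conditional law of the ranking given `X = x`. -/
def risk (μ : Measure α) (P : Kernel α (Ranking n)) (s : α → Ranking n) : ℝ :=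
  ∫ x, medianRisk (P x) (s x) ∂μ

/-- `R*`, the infimum of the risk over all measurable ranking rules. -/
def optimalRisk (μ : Measure α) (P : Kernel α (Ranking n)) : ℝ :=
  ⨅ s : {s : α → Ranking n // Measurable s}, risk μ P s.1

/-- A training sample of size `N`. -/
abbrev Sample (α : Type*) (n N : ℕ) : Type _ := Fin N → α × Ranking n

/-- A finite partition of the input space into (nonempty) measurable cells. -/
structure BorelPartition (α : Type*) [MeasurableSpace α] where
  cells : Set (Set α)
  isPartition : Setoid.IsPartition cells
  finite : cells.Finite
  measurable : ∀ C ∈ cells, MeasurableSet C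

/-- An `N`-sample partitioning rule: it maps every sample to a partition, in such a way that the
relation `x and x' lie in the same cell of the partition built on D` is jointly measurable
in `(D, x, x')`. -/
structure PartitioningRule (α : Type*) [MeasurableSpace α] (n N : ℕ) where
  toFun : Sample α n N → BorelPartition α
  measurable_sameCell : MeasurableSet
    {q : Sample α n N × (α × α) | ∃ C ∈ (toFun q.1).cells, q.2.1 ∈ C ∧ q.2.2 ∈ C}

/-- The `N`-th shatter coefficient of a class of sets: the largest number of subsets of a family of
`N` points that can be picked out by intersecting it with a set of the class. -/
def shatterCoeff {α : Type*} (𝒜 : Set (Set α)) (N : ℕ) : ℕ :=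
  ⨆ x : Fin N → α, Set.ncard {T : Set (Fin N) | ∃ A ∈ 𝒜, T = x ⁻¹' A}

/-- The sets that are unions of cells of one of the partitions of the family `ℱ`. -/
def unionsOfCells (ℱ : Set (BorelPartition α)) : Set (Set α) :=
  {A | ∃ 𝒬 ∈ ℱ, ∃ 𝒞 ⊆ 𝒬.cells, A = ⋃₀ 𝒞}

/-- `Δ_N(ℱ_N)`, for the family `ℱ_N` of all the partitions that the rule `π` can output. -/
def PartitioningRule.shatter {N : ℕ} (π : PartitioningRule α n N) : ℕ :=
  shatterCoeff (unionsOfCells (Set.range π.toFun)) N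

/-- `κ = inf {μ(C) : C a cell}`. -/
def BorelPartition.minMass (𝒬 : BorelPartition α) (μ : Measure α) : ℝ≥0∞ :=
  ⨅ C ∈ 𝒬.cells, μ C

open Classical in
/-- The indices of the sample points that fall in `C`. -/
def inCell {N : ℕ} (D : Sample α n N) (C : Set α) : Finset (Fin N) :=
  Finset.univ.filter fun k => (D k).1 ∈ C

/-- The empirical law of the ranking on `C`; it is the zero measure if no sample point
falls in `C`. -/
def empiricalLaw {N : ℕ} (D : Sample α n N) (C : Set α) : Measure (Ranking n) :=
  (((inCell D C).card : ℝ≥0∞))⁻¹ • ∑ k ∈ inCell D C, Measure.dirac (D k).2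

/-- The empirical Borda count of item `i` on `C`. -/
def bordaCount {N : ℕ} (D : Sample α n N) (C : Set α) (i : Fin n) : ℤ :=
  ∑ k ∈ inCell D C, (((D k).2 i : ℕ) : ℤ)

/-- `σ` is a pseudo-empirical median on `C`: it is the Kemeny median of the empirical law on `C` if
that law is strictly stochastically transitive, and otherwise it ranks the items as the empirical
Borda count does, ties being broken arbitrarily. -/
def IsPseudoMedian {N : ℕ} (D : Sample α n N) (C : Set α) (σ : Ranking n) : Prop :=
  (StrictlyTransitive (empiricalLaw D C) → IsKemenyMedian (empiricalLaw D C) σ) ∧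
  (¬ StrictlyTransitive (empiricalLaw D C) →
    ∀ i j : Fin n, i < j → bordaCount D C i ≠ bordaCount D C j →
      0 < (bordaCount D C i - bordaCount D C j) * (((σ i : ℕ) : ℤ) - ((σ j : ℕ) : ℤ)))

/-- `s` is constant on every cell of `𝒬`, and its value on a cell of positive mass is a Kemeny
median of the empirical law on that cell. -/
def IsLocalMedianRule {N : ℕ} (μ : Measure α) (𝒬 : BorelPartition α) (D : Sample α n N)
    (s : α → Ranking n) : Prop :=
  ∀ C ∈ 𝒬.cells, ∃ σ : Ranking n,
    (∀ x ∈ C, s x = σ) ∧ (μ C ≠ 0 → IsKemenyMedian (empiricalLaw D C) σ)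

/-- `s` is constant on every cell of `𝒬`, and its value on a cell of positive mass is a
pseudo-empirical median on that cell. -/
def IsLocalPseudoMedianRule {N : ℕ} (μ : Measure α) (𝒬 : BorelPartition α) (D : Sample α n N)
    (s : α → Ranking n) : Prop :=
  ∀ C ∈ 𝒬.cells, ∃ σ : Ranking n,
    (∀ x ∈ C, s x = σ) ∧ (μ C ≠ 0 → IsPseudoMedian D C σ)

/-- The noise condition: all the conditional laws lie in `𝒯`, and the conditional pairwise
probabilities stay uniformly away from `1/2`. -/
def UniformLowNoise (P : Kernel α (Ranking n)) : Prop :=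
  (∀ x, StrictlyTransitive (P x)) ∧
    ∃ H : ℝ, 0 < H ∧ ∀ x, ∀ i j : Fin n, i < j → H ≤ |pairProb (P x) i j - 1 / 2|

end Risk

section Metric

variable {α : Type*} [PseudoMetricSpace α] [MeasurableSpace α] {n : ℕ}

/-- `δ_𝒬`, the maximal diameter of the cells. -/
def BorelPartition.maxDiam (𝒬 : BorelPartition α) : ℝ :=
  ⨆ C : 𝒬.cells, Metric.diam (C : Set α)

/-- The conditional pairwise probabilities are Lipschitz functions of the input. -/
def LipschitzPairProb (P : Kernel α (Ranking n)) : Prop :=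
  ∃ M : ℝ, ∀ x x' : α,
    ∑ p ∈ itemPairs n, |pairProb (P x) p.1 p.2 - pairProb (P x') p.1 p.2| ≤ M * dist x x'

end Metric

section Probability

variable {Ω : Type*} [MeasurableSpace Ω]

/-- `Z_N = o_P(a_N)` for nonnegative, possibly infinite, `Z_N`:
for every `ε > 0`, the probability that `Z_N > ε a_N` tends to zero. -/
def IsLittleOInProb (Pr : Measure Ω) (Z : ℕ → Ω → ℝ≥0∞) (a : ℕ → ℝ) : Prop :=
  ∀ ε : ℝ, 0 < ε →
    Tendsto (fun N => Pr {ω | ENNReal.ofReal (ε * a N) < Z N ω}) atTop (𝓝 0)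

/-- The first `N` observations. -/
def firstObs {α : Type*} {n : ℕ} (Z : ℕ → Ω → α × Ranking n) (N : ℕ) (ω : Ω) : Sample α n N :=
  fun k => Z k ω

/-- Consistency of a sequence of (data-dependent) rules: `R(s_N) → R*` in probability. -/
def Consistent {α : Type*} [MeasurableSpace α] {n : ℕ} (Pr : Measure Ω) (μ : Measure α)
    (P : Kernel α (Ranking n)) (s : ℕ → Ω → α → Ranking n) : Prop :=
  TendstoInMeasure Pr (fun N ω => risk μ P (s N ω)) atTop (fun _ => optimalRisk μ P)

end Probability

end RankingMedian

end

namespace RankingMedian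

/-! The risk `L_Q` depends on `Q` only through its pairwise probabilities. If on every cell the
empirical ones are within `η` of those of `P_x`, for all `x` in the cell, then a local Kemeny median
loses at most `2 * (n choose 2) * η` at every `x`, hence also after integration. So it suffices that
this local accuracy (`LocallyAccurate`) holds with probability tending to one
(`tendsto_measure_not_locallyAccurate`).

The error on a cell `C` is a bias, at most `M` times the diameter of `C`, plus a random part. An
empirical probability on `C` is a quotient of two empirical frequencies, so if these deviate by at
most `t`, the random part is at most `2 t / μ(C)`. A Vapnik–Chervonenkis inequality
(`measure_exists_lt_abs_empFreq_sub_le`) allows `t = K √(log Δ_N / N)`, and the condition on `κ_N`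
makes `t / μ(C)` small. The cells depend on the sample, so the inequality is proved by
symmetrization for measurably selected sets only, which avoids measurability questions about suprema
over the whole class.

With a margin `H` around `1/2`, accuracy `η < H` forces the empirical laws into `𝒯`; pseudo-medians
are then Kemeny medians. -/

/-- The sign `±1` attached to a Boolean. -/
def boolSign (b : Bool) : ℝ := if b then 1 else -1

/-! ### Hoeffding's inequality for random signs -/

open Classical in
lemma card_signs_lt_sum_le {N : ℕ} (a : Fin N → ℝ) (ha : ∀ k, |a k| ≤ 1) {u : ℝ} (hu : 0 ≤ u) :
    ((Finset.univ.filter fun ε : Fin N → Bool => u < ∑ k, boolSign (ε k) * a k).card : ℝ)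
      ≤ 2 ^ N * Real.exp (-(u ^ 2 / (2 * N))) := by
  rcases Nat.eq_zero_or_pos N with rfl | hN
  · simp [not_lt.2 hu]
  have hN' : (0 : ℝ) < N := by exact_mod_cast hN
  -- Chernoff's method: this `l` minimizes the exponent `N * l ^ 2 / 2 - l * u`.
  set l : ℝ := u / N with hl
  have hl0 : 0 ≤ l := by positivity
  have h1 : ((Finset.univ.filter fun ε : Fin N → Bool =>
      u < ∑ k, boolSign (ε k) * a k).card : ℝ)
      ≤ ∑ ε : Fin N → Bool, Real.exp (l * (∑ k, boolSign (ε k) * a k - u)) := by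
    rw [Finset.card_filter, Nat.cast_sum]
    refine Finset.sum_le_sum fun ε _ => ?_
    split_ifs with h
    · rw [Nat.cast_one, Real.one_le_exp_iff]
      exact mul_nonneg hl0 (sub_nonneg.2 h.le)
    · simpa using (Real.exp_pos _).le
  have h2 : ∑ ε : Fin N → Bool, Real.exp (l * (∑ k, boolSign (ε k) * a k - u))
      = Real.exp (-(l * u)) * ∏ k, (2 * Real.cosh (l * a k)) := by
    have : ∀ k, 2 * Real.cosh (l * a k) = ∑ b : Bool, Real.exp (l * (boolSign b * a k)) := by
      intro k
      rw [Real.cosh_eq]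
      simp [boolSign]
      ring
    simp_rw [this]
    rw [Finset.prod_univ_sum, Finset.mul_sum, Fintype.piFinset_univ]
    refine Finset.sum_congr rfl fun ε _ => ?_
    rw [← Real.exp_sum, ← Real.exp_add, ← Finset.mul_sum]
    congr 1
    ring
  have h3 : ∏ k, (2 * Real.cosh (l * a k)) ≤ ∏ _k : Fin N, (2 * Real.exp (l ^ 2 / 2)) := by
    refine Finset.prod_le_prod (fun k _ => by positivity) fun k _ => ?_
    refine mul_le_mul_of_nonneg_left ((Real.cosh_le_exp_half_sq _).trans ?_) zero_le_two
    rw [Real.exp_le_exp, mul_pow]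
    have : a k ^ 2 ≤ 1 := (sq_le_one_iff_abs_le_one _).2 (ha k)
    nlinarith [sq_nonneg l]
  rw [Finset.prod_const, Finset.card_univ, Fintype.card_fin, mul_pow, ← Real.exp_nat_mul] at h3
  refine h1.trans (h2.le.trans ((mul_le_mul_of_nonneg_left h3 (Real.exp_pos _).le).trans
    (le_of_eq ?_)))
  rw [mul_left_comm, ← Real.exp_add]
  congr 2
  rw [hl]
  field_simp
  ring

open Classical in
/-- Hoeffding's inequality for a weighted sum of independent fair signs, in counting form. -/
lemma card_signs_lt_abs_sum_le {N : ℕ} (a : Fin N → ℝ) (ha : ∀ k, |a k| ≤ 1) {u : ℝ}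
    (hu : 0 ≤ u) :
    ((Finset.univ.filter fun ε : Fin N → Bool => u < |∑ k, boolSign (ε k) * a k|).card : ℝ)
      ≤ 2 ^ N * (2 * Real.exp (-(u ^ 2 / (2 * N)))) := by
  have h1 := card_signs_lt_sum_le a ha hu
  have h2 := card_signs_lt_sum_le (fun k => -a k) (fun k => by simpa using ha k) hu
  have h3 : (Finset.univ.filter fun ε : Fin N → Bool => u < |∑ k, boolSign (ε k) * a k|)
      ⊆ (Finset.univ.filter fun ε : Fin N → Bool => u < ∑ k, boolSign (ε k) * a k) ∪
        (Finset.univ.filter fun ε : Fin N → Bool => u < ∑ k, boolSign (ε k) * -a k) := by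
    intro ε
    simp [lt_abs]
  have h4 := (Finset.card_le_card h3).trans (Finset.card_union_le _ _)
  refine (Nat.cast_le.2 h4).trans ?_
  push_cast
  linarith

/-! ### Symmetrization and the Vapnik–Chervonenkis inequality -/

section Symmetrization

variable {𝒵 : Type*} {N : ℕ}

open Classical in
/-- The fraction of the points of the sample `D` that fall in `A`. -/
noncomputable def empFreq (D : Fin N → 𝒵) (A : Set 𝒵) : ℝ :=
  (∑ k, if D k ∈ A then (1 : ℝ) else 0) / N

open Classical in
/-- Union bound over the traces of a class of sets, for sums of random signs. -/
lemma card_signs_exists_le (𝒜 : Set (Set 𝒵)) (Δ : ℕ)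
    (z : Fin N → 𝒵) (hΔ : {T : Set (Fin N) | ∃ A ∈ 𝒜, T = z ⁻¹' A}.ncard ≤ Δ)
    {u : ℝ} (hu : 0 ≤ u) :
    ((Finset.univ.filter fun ε : Fin N → Bool =>
      ∃ A ∈ 𝒜, u < |∑ k, boolSign (ε k) * (if z k ∈ A then (1 : ℝ) else 0)|).card : ℝ)
      ≤ Δ * (2 ^ N * (2 * Real.exp (-(u ^ 2 / (2 * N))))) := by
  set 𝒯 := {T : Set (Fin N) | ∃ A ∈ 𝒜, T = z ⁻¹' A}
  rw [Set.ncard_eq_toFinset_card' 𝒯] at hΔ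
  have h1 : (Finset.univ.filter fun ε : Fin N → Bool =>
      ∃ A ∈ 𝒜, u < |∑ k, boolSign (ε k) * (if z k ∈ A then (1 : ℝ) else 0)|)
      ⊆ 𝒯.toFinset.biUnion fun T => Finset.univ.filter fun ε : Fin N → Bool =>
        u < |∑ k, boolSign (ε k) * (if k ∈ T then (1 : ℝ) else 0)| := by
    intro ε hε
    simp only [Finset.mem_filter, Finset.mem_univ, true_and] at hε
    obtain ⟨A, hA, h⟩ := hε
    simp only [Finset.mem_biUnion, Set.mem_toFinset, Finset.mem_filter, Finset.mem_univ, true_and]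
    exact ⟨z ⁻¹' A, ⟨A, hA, rfl⟩, h⟩
  calc _ ≤ ((∑ T ∈ 𝒯.toFinset, (Finset.univ.filter fun ε : Fin N → Bool =>
        u < |∑ k, boolSign (ε k) * (if k ∈ T then (1 : ℝ) else 0)|).card : ℕ) : ℝ) := by
        exact_mod_cast (Finset.card_le_card h1).trans Finset.card_biUnion_le
    _ ≤ ∑ T ∈ 𝒯.toFinset, 2 ^ N * (2 * Real.exp (-(u ^ 2 / (2 * N)))) := by
        push_cast
        refine Finset.sum_le_sum fun T _ => card_signs_lt_abs_sum_le _ (fun k => ?_) hu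
        split_ifs <;> simp
    _ ≤ _ := by
        rw [Finset.sum_const, nsmul_eq_mul]
        have : (𝒯.toFinset.card : ℝ) ≤ Δ := by exact_mod_cast hΔ
        gcongr

/-- Exchange the two coordinates of `q k` whenever `ε k` is false. -/
def signSwap (ε : Fin N → Bool) (q : Fin N → 𝒵 × 𝒵) : Fin N → 𝒵 × 𝒵 :=
  fun k => if ε k then q k else (q k).swap

/-- An exchange only flips the sign of the `k`-th difference. The two halves are kept as separate
sums so that traces are counted on `N` points, not on `2N`. -/
lemma empFreq_signSwap_sub (ε : Fin N → Bool) (q : Fin N → 𝒵 × 𝒵) (A : Set 𝒵) :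
    letI := Classical.decPred (· ∈ A)
    empFreq (fun k => (signSwap ε q k).1) A - empFreq (fun k => (signSwap ε q k).2) A
      = ((∑ k, boolSign (ε k) * (if (q k).1 ∈ A then (1 : ℝ) else 0))
        - ∑ k, boolSign (ε k) * (if (q k).2 ∈ A then (1 : ℝ) else 0)) / N := by
  classical
  simp only [empFreq, ← sub_div, ← Finset.sum_sub_distrib]
  congr 1
  refine Finset.sum_congr rfl fun k _ => ?_
  cases h : ε k
  · simp only [signSwap, boolSign, h, Bool.false_eq_true, if_false, Prod.fst_swap, Prod.snd_swap]
    ring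
  · simp [signSwap, boolSign, h]

lemma measurable_empFreq {β : Type*} [MeasurableSpace β] {f : β → Fin N → 𝒵} {A : β → Set 𝒵}
    (h : ∀ k, MeasurableSet {b | f b k ∈ A b}) : Measurable fun b => empFreq (f b) (A b) := by
  unfold empFreq
  refine Measurable.div_const (Finset.measurable_sum _ fun k _ => ?_) _
  exact Measurable.ite (h k) measurable_const measurable_const

variable [MeasurableSpace 𝒵] (ν : Measure 𝒵) [IsProbabilityMeasure ν]

lemma measurePreserving_signSwap (ε : Fin N → Bool) :
    MeasurePreserving (signSwap ε) (Measure.pi fun _ : Fin N => ν.prod ν)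
      (Measure.pi fun _ : Fin N => ν.prod ν) := by
  have h : ∀ b : Bool, MeasurePreserving (fun p : 𝒵 × 𝒵 => if b then p else p.swap)
      (ν.prod ν) (ν.prod ν) := by
    intro b
    cases b
    · exact ⟨measurable_swap, Measure.prod_swap⟩
    · exact MeasurePreserving.id _
  exact measurePreserving_pi _ _ fun k => h (ε k)

/-- Chebyshev's inequality for the empirical frequency of a fixed event. -/
lemma measure_lt_abs_empFreq_sub_le {A : Set 𝒵} (hA : MeasurableSet A) {t : ℝ} (ht : 0 < t)
    (hNt : 2 ≤ N * t ^ 2) :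
    (Measure.pi fun _ : Fin N => ν) {D | t / 2 < |empFreq D A - ν.real A|} ≤ 1 / 2 := by
  classical
  set ρ := Measure.pi fun _ : Fin N => ν
  have hN : (0 : ℝ) < N := by
    by_contra h
    have : (N : ℝ) = 0 := le_antisymm (not_lt.1 h) (by positivity)
    rw [this] at hNt
    linarith
  set g : 𝒵 → ℝ := fun z => if z ∈ A then (1 : ℝ) else 0 with hg
  have hgm : Measurable g := Measurable.ite hA measurable_const measurable_const
  have hgb : ∀ z, g z ∈ Set.Icc (0 : ℝ) 1 := by
    intro z
    simp only [hg]
    split_ifs <;> simp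
  have hgL : MemLp g 2 ν := MemLp.of_bound hgm.aestronglyMeasurable 1
    (ae_of_all _ fun z => by rw [Real.norm_eq_abs, abs_of_nonneg (hgb z).1]; exact (hgb z).2)
  have hgi : ∫ z, g z ∂ν = ν.real A := by
    have : g = A.indicator 1 := by
      ext z
      simp [hg, Set.indicator_apply]
    rw [this, integral_indicator_one hA]
  have hX : ∀ k, MemLp (fun D : Fin N → 𝒵 => g (D k)) 2 ρ := fun k =>
    hgL.comp_measurePreserving (measurePreserving_eval (fun _ : Fin N => ν) k)
  have hSL : MemLp (∑ k, fun D : Fin N → 𝒵 => g (D k)) 2 ρ := memLp_finsetSum' _ fun k _ => hX k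
  have hmean : ρ[∑ k, fun D : Fin N → 𝒵 => g (D k)] = N * ν.real A := by
    have : ∀ k : Fin N, ∫ D, g (D k) ∂ρ = ν.real A := by
      intro k
      rw [← hgi]
      rw [← (measurePreserving_eval (fun _ : Fin N => ν) k).map_eq,
        integral_map (measurable_pi_apply k).aemeasurable hgm.aestronglyMeasurable]
    simp only [Finset.sum_apply]
    rw [integral_finsetSum _ fun k _ => (hX k).integrable one_le_two]
    simp [this]
  have hvar : Var[∑ k, fun D : Fin N → 𝒵 => g (D k); ρ] ≤ N / 4 := by
    rw [variance_sum_pi fun _ => hgL]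
    calc _ ≤ ∑ _k : Fin N, ((1 - 0 : ℝ) / 2) ^ 2 := Finset.sum_le_sum fun k _ =>
          variance_le_sq_of_bounded (ae_of_all _ hgb) hgm.aemeasurable
      _ = N / 4 := by simp; ring
  have hc : 0 < N * (t / 2) := by positivity
  have hch := meas_ge_le_variance_div_sq hSL hc
  rw [hmean] at hch
  refine (measure_mono fun D hD => ?_).trans (hch.trans ?_)
  · simp only [Set.mem_ofPred_eq, Finset.sum_apply] at hD ⊢
    have : ∑ k, g (D k) - N * ν.real A = N * (empFreq D A - ν.real A) := by
      simp only [empFreq, hg]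
      field_simp
    rw [this, abs_mul, abs_of_pos hN]
    gcongr
  · have : (1 / 2 : ℝ≥0∞) = ENNReal.ofReal (1 / 2) := by
      rw [ENNReal.ofReal_div_of_pos two_pos]; simp
    rw [this]
    -- Chebyshev's bound is `(N / 4) / (N * t / 2) ^ 2 = 1 / (N * t ^ 2)`.
    refine ENNReal.ofReal_le_ofReal ?_
    rw [div_le_div_iff₀ (by positivity) two_pos]
    nlinarith

variable {α : Type*} [MeasurableSpace α] (μ : Measure α) [SFinite μ]

/-- The Vapnik–Chervonenkis inequality for sets selected by the sample: the sets `{z | (D, x, z) ∈ W}`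
depend measurably on the sample `D` and on an index `x`, and only those which are selected by a
non-negligible set of indices are considered. -/
theorem measure_exists_lt_abs_empFreq_sub_le {W : Set ((Fin N → 𝒵) × (α × 𝒵))}
    (hW : MeasurableSet W) {𝒜 : Set (Set 𝒵)} (h𝒜 : ∀ D x, {z | (D, (x, z)) ∈ W} ∈ 𝒜) {Δ : ℕ}
    (hΔ : ∀ z : Fin N → 𝒵, {T : Set (Fin N) | ∃ A ∈ 𝒜, T = z ⁻¹' A}.ncard ≤ Δ)
    {t : ℝ} (ht : 0 < t) (hNt : 2 ≤ N * t ^ 2) :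
    (Measure.pi fun _ : Fin N => ν)
      {D | ∃ A, t < |empFreq D A - ν.real A| ∧ μ {x | {z | (D, (x, z)) ∈ W} = A} ≠ 0}
      ≤ ENNReal.ofReal (8 * Δ * Real.exp (-(N * t ^ 2 / 32))) := by
  classical
  set ρ := Measure.pi fun _ : Fin N => ν with hρ
  set ρ₂ := Measure.pi fun _ : Fin N => ν.prod ν with hρ₂
  have hN : (0 : ℝ) < N := by
    by_contra h
    have : (N : ℝ) = 0 := le_antisymm (not_lt.1 h) (by positivity)
    rw [this] at hNt
    linarith
  set G : Set (((Fin N → 𝒵) × (Fin N → 𝒵)) × α) := {p | t / 2 <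
    |empFreq p.1.1 {z | (p.1.1, (p.2, z)) ∈ W} - empFreq p.1.2 {z | (p.1.1, (p.2, z)) ∈ W}|} with hG
  have hGm : MeasurableSet G := by
    refine measurableSet_lt measurable_const (Measurable.abs (Measurable.sub ?_ ?_)) <;>
    · refine measurable_empFreq fun k => ?_
      exact measurableSet_preimage (by fun_prop) hW
  -- Requiring a non-null set of indices, rather than one index, makes this event measurable by
  -- Fubini.
  set B₂ : Set ((Fin N → 𝒵) × (Fin N → 𝒵)) := {p | μ (Prod.mk p ⁻¹' G) ≠ 0} with hB₂
  have hB₂m : MeasurableSet B₂ :=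
    measurable_measure_prodMk_left hGm (measurableSet_singleton (0 : ℝ≥0∞)).compl
  -- comparison with the ghost sample
  have hghost : (1 / 2) * ρ {D | ∃ A, t < |empFreq D A - ν.real A| ∧
      μ {x | {z | (D, (x, z)) ∈ W} = A} ≠ 0} ≤ (ρ.prod ρ) B₂ := by
    rw [Measure.prod_apply hB₂m]
    -- Markov's inequality is applied to the measurable set of `D` whose fibre has mass at least
    -- `1/2`; the bad event inside it need not be measurable.
    refine le_trans ?_ (mul_meas_ge_le_lintegral (measurable_measure_prodMk_left hB₂m) (1 / 2))
    refine mul_le_mul_right (measure_mono ?_) _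
    rintro D ⟨A, hA, hμ⟩
    obtain ⟨x₀, hx₀⟩ := nonempty_of_measure_ne_zero hμ
    have hAm : MeasurableSet A := by
      rw [← hx₀]
      exact measurableSet_preimage (by fun_prop : Measurable fun z : 𝒵 => (D, (x₀, z))) hW
    -- With `D` frozen, `A` is a fixed set, so Chebyshev's inequality applies to the ghost sample
    -- `D'`.
    have h1 := measure_lt_abs_empFreq_sub_le ν hAm ht hNt
    have h2 : {D' : Fin N → 𝒵 | t / 2 < |empFreq D' A - ν.real A|}ᶜ ⊆ Prod.mk D ⁻¹' B₂ := by
      intro D' hD'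
      refine fun h0 => hμ (measure_mono_null (fun x hx => ?_) h0)
      simp only [Set.mem_ofPred_eq] at hx
      simp only [hG, Set.mem_preimage, Set.mem_ofPred_eq, hx]
      simp only [Set.mem_compl_iff, Set.mem_ofPred_eq, not_lt] at hD'
      have := abs_sub_le (empFreq D A) (empFreq D' A) (ν.real A)
      linarith
    have hm : MeasurableSet {D' : Fin N → 𝒵 | t / 2 < |empFreq D' A - ν.real A|} := by
      refine measurableSet_lt measurable_const (Measurable.abs (Measurable.sub ?_ measurable_const))
      exact measurable_empFreq fun k => measurableSet_preimage (measurable_pi_apply k) hAm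
    refine le_trans ?_ (measure_mono h2)
    rw [prob_compl_eq_one_sub hm]
    refine le_trans ?_ (tsub_le_tsub_left h1 1)
    rw [one_div, ENNReal.one_sub_inv_two]
  -- transfer to a sample of pairs
  set e := MeasurableEquiv.arrowProdEquivProdArrow 𝒵 𝒵 (Fin N)
  have he : MeasurePreserving e ρ₂ (ρ.prod ρ) :=
    measurePreserving_arrowProdEquivProdArrow 𝒵 𝒵 (Fin N) (fun _ => ν) (fun _ => ν)
  set B₃ := e ⁻¹' B₂ with hB₃
  have hB₃m : MeasurableSet B₃ := e.measurable hB₂m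
  have h3 : (ρ.prod ρ) B₂ = ρ₂ B₃ := (he.measure_preimage hB₂m.nullMeasurableSet).symm
  -- average over the exchanges
  have h4 : (2 ^ N : ℝ≥0∞) * ρ₂ B₃
      = ∫⁻ q, ((Finset.univ.filter fun ε : Fin N → Bool => signSwap ε q ∈ B₃).card : ℝ≥0∞) ∂ρ₂ := by
    have h5 : ∀ ε : Fin N → Bool, ρ₂ B₃ = ∫⁻ q, if signSwap ε q ∈ B₃ then 1 else 0 ∂ρ₂ := by
      intro ε
      rw [← (measurePreserving_signSwap ν ε).measure_preimage hB₃m.nullMeasurableSet,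
        ← lintegral_indicator_one ((measurePreserving_signSwap ν ε).measurable hB₃m)]
      rfl
    have h6 : ∑ _ε : Fin N → Bool, ρ₂ B₃ = (2 ^ N : ℝ≥0∞) * ρ₂ B₃ := by
      simp
    rw [← h6, Finset.sum_congr rfl fun ε _ => h5 ε, ← lintegral_finsetSum]
    · refine lintegral_congr fun q => ?_
      rw [Finset.card_filter]
      push_cast
      rfl
    · intro ε _
      exact Measurable.ite ((measurePreserving_signSwap ν ε).measurable hB₃m) measurable_const
        measurable_const
  -- The selected set varies with `ε`, but it stays in `𝒜`, whose traces on each half of `q` do not.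
  -- A difference above `N * t / 2` makes one of the two signed sums exceed `N * t / 4`.
  have h7 : ∀ q : Fin N → 𝒵 × 𝒵,
      ((Finset.univ.filter fun ε : Fin N → Bool => signSwap ε q ∈ B₃).card : ℝ)
        ≤ 2 ^ N * (4 * Δ * Real.exp (-(N * t ^ 2 / 32))) := by
    intro q
    have hu : 0 ≤ N * (t / 4) := by positivity
    have h8 := card_signs_exists_le 𝒜 Δ (fun k => (q k).1) (hΔ _) hu
    have h9 := card_signs_exists_le 𝒜 Δ (fun k => (q k).2) (hΔ _) hu
    have h10 : (Finset.univ.filter fun ε : Fin N → Bool => signSwap ε q ∈ B₃) ⊆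
        (Finset.univ.filter fun ε : Fin N → Bool => ∃ A ∈ 𝒜,
          N * (t / 4) < |∑ k, boolSign (ε k) * (if (q k).1 ∈ A then (1 : ℝ) else 0)|) ∪
        (Finset.univ.filter fun ε : Fin N → Bool => ∃ A ∈ 𝒜,
          N * (t / 4) < |∑ k, boolSign (ε k) * (if (q k).2 ∈ A then (1 : ℝ) else 0)|) := by
      intro ε hε
      simp only [Finset.mem_filter, Finset.mem_univ, true_and, Finset.mem_union] at hε ⊢
      obtain ⟨x, hx⟩ := nonempty_of_measure_ne_zero hε
      set A := {z | ((e (signSwap ε q)).1, (x, z)) ∈ W} with hA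
      have hx' : t / 2 < |empFreq (fun k => (signSwap ε q k).1) A
          - empFreq (fun k => (signSwap ε q k).2) A| := hx
      rw [empFreq_signSwap_sub, abs_div, Nat.abs_cast, lt_div_iff₀ hN] at hx'
      have hor := lt_of_lt_of_le hx' (abs_sub _ _)
      by_contra! hcon
      have hc1 := hcon.1 A (h𝒜 _ _)
      have hc2 := hcon.2 A (h𝒜 _ _)
      linarith
    have h12 : (N * (t / 4)) ^ 2 / (2 * (N : ℝ)) = N * t ^ 2 / 32 := by
      field_simp
      ring
    rw [h12] at h8 h9
    refine (Nat.cast_le.2 ((Finset.card_le_card h10).trans (Finset.card_union_le _ _))).trans ?_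
    push_cast
    linarith
  have h8 : (2 ^ N : ℝ≥0∞) * ρ₂ B₃
      ≤ 2 ^ N * ENNReal.ofReal (4 * Δ * Real.exp (-(N * t ^ 2 / 32))) := by
    rw [h4]
    refine (lintegral_mono (g := fun _ => 2 ^ N *
      ENNReal.ofReal (4 * Δ * Real.exp (-(N * t ^ 2 / 32)))) fun q => ?_).trans (by simp)
    have := ENNReal.ofReal_le_ofReal (h7 q)
    rwa [ENNReal.ofReal_natCast, ENNReal.ofReal_mul (by positivity),
      ENNReal.ofReal_pow zero_le_two, ENNReal.ofReal_ofNat] at this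
  have h9 : ρ₂ B₃ ≤ ENNReal.ofReal (4 * Δ * Real.exp (-(N * t ^ 2 / 32))) :=
    (ENNReal.mul_le_mul_iff_right (by simp) (by simp)).1 h8
  rw [h3] at hghost
  have h10 := mul_le_mul_right (hghost.trans h9) 2
  rw [← mul_assoc, one_div, ENNReal.mul_inv_cancel two_ne_zero ENNReal.ofNat_ne_top, one_mul] at h10
  refine h10.trans (le_of_eq ?_)
  rw [← ENNReal.ofReal_ofNat 2, ← ENNReal.ofReal_mul zero_le_two]
  congr 1
  ring

end Symmetrization

/-! ### Stability of Kemeny medians and of transitivity -/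

section Rankings

variable {n : ℕ}

lemma kendall_eq_sum (τ σ : Ranking n) :
    (kendall τ σ : ℝ) = ∑ p ∈ itemPairs n, if σ p.1 < σ p.2 then
      {ρ : Ranking n | ρ p.1 < ρ p.2}ᶜ.indicator 1 τ
      else {ρ : Ranking n | ρ p.1 < ρ p.2}.indicator 1 τ := by
  rw [kendall, Finset.card_filter, Nat.cast_sum]
  refine Finset.sum_congr rfl fun p hp => ?_
  have hp' : p.1 < p.2 := (Finset.mem_filter.1 hp).2
  have hτ : τ p.1 ≠ τ p.2 := fun h => hp'.ne (τ.injective h)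
  have hσ : σ p.1 ≠ σ p.2 := fun h => hp'.ne (σ.injective h)
  rcases lt_or_gt_of_ne hτ with h | h <;> rcases lt_or_gt_of_ne hσ with h' | h'
  · have : ¬ (((τ p.1 : ℕ) : ℤ) - ((τ p.2 : ℕ) : ℤ)) * (((σ p.1 : ℕ) : ℤ) - ((σ p.2 : ℕ) : ℤ)) < 0 :=
      not_lt.2 (mul_nonneg_of_nonpos_of_nonpos (by omega) (by omega))
    simp [this, h, h']
  · have : (((τ p.1 : ℕ) : ℤ) - ((τ p.2 : ℕ) : ℤ)) * (((σ p.1 : ℕ) : ℤ) - ((σ p.2 : ℕ) : ℤ)) < 0 :=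
      mul_neg_of_neg_of_pos (by omega) (by omega)
    simp [this, h, h'.not_gt]
  · have : (((τ p.1 : ℕ) : ℤ) - ((τ p.2 : ℕ) : ℤ)) * (((σ p.1 : ℕ) : ℤ) - ((σ p.2 : ℕ) : ℤ)) < 0 :=
      mul_neg_of_pos_of_neg (by omega) (by omega)
    simp [this, h', h.le]
  · have : ¬ (((τ p.1 : ℕ) : ℤ) - ((τ p.2 : ℕ) : ℤ)) * (((σ p.1 : ℕ) : ℤ) - ((σ p.2 : ℕ) : ℤ)) < 0 :=
      not_lt.2 (mul_nonneg (by omega) (by omega))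
    simp [this, h.not_gt, h'.not_gt]

/-- The expected Kendall distance is determined by the pairwise probabilities. -/
lemma medianRisk_eq_sum (Q : Measure (Ranking n)) [IsProbabilityMeasure Q] (σ : Ranking n) :
    medianRisk Q σ = ∑ p ∈ itemPairs n,
      if σ p.1 < σ p.2 then 1 - pairProb Q p.1 p.2 else pairProb Q p.1 p.2 := by
  simp only [medianRisk, kendall_eq_sum]
  rw [integral_finsetSum _ fun p _ => Integrable.of_finite]
  refine Finset.sum_congr rfl fun p _ => ?_
  have hm : MeasurableSet {ρ : Ranking n | ρ p.1 < ρ p.2} := trivial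
  split_ifs
  · rw [integral_indicator_one hm.compl, probReal_compl_eq_one_sub hm, pairProb]
  · rw [integral_indicator_one hm, pairProb]

lemma pairProb_swap (Q : Measure (Ranking n)) [IsProbabilityMeasure Q] {i j : Fin n} (h : i ≠ j) :
    pairProb Q j i = 1 - pairProb Q i j := by
  have hm : MeasurableSet {ρ : Ranking n | ρ i < ρ j} := trivial
  rw [pairProb, pairProb, ← probReal_compl_eq_one_sub hm]
  congr 1
  ext ρ
  have : ρ i ≠ ρ j := fun h' => h (ρ.injective h')
  simp [this.symm.le_iff_lt]

lemma medianRisk_nonneg (Q : Measure (Ranking n)) (σ : Ranking n) : 0 ≤ medianRisk Q σ :=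
  integral_nonneg fun _ => Nat.cast_nonneg _

lemma abs_medianRisk_le (Q : Measure (Ranking n)) [IsProbabilityMeasure Q] (σ : Ranking n) :
    |medianRisk Q σ| ≤ (itemPairs n).card := by
  have h : ∀ τ : Ranking n, ‖(kendall τ σ : ℝ)‖ ≤ (itemPairs n).card := fun τ => by
    rw [Real.norm_natCast]
    exact_mod_cast Finset.card_filter_le _ _
  simpa [medianRisk] using norm_integral_le_of_norm_le_const (μ := Q) (ae_of_all _ h)

/-- Each pair contributes `p` or `1 - p`, both 1-Lipschitz in `p`. -/
lemma abs_medianRisk_sub_le {Q Q' : Measure (Ranking n)} [IsProbabilityMeasure Q]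
    [IsProbabilityMeasure Q'] {η : ℝ}
    (h : ∀ p ∈ itemPairs n, |pairProb Q' p.1 p.2 - pairProb Q p.1 p.2| ≤ η) (σ : Ranking n) :
    |medianRisk Q' σ - medianRisk Q σ| ≤ (itemPairs n).card * η := by
  rw [medianRisk_eq_sum, medianRisk_eq_sum, ← Finset.sum_sub_distrib, ← nsmul_eq_mul]
  refine (Finset.abs_sum_le_sum_abs _ _).trans (Finset.sum_le_card_nsmul _ _ _ fun p hp => ?_)
  have := h p hp
  split_ifs
  · rwa [sub_sub_sub_cancel_left, abs_sub_comm]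
  · exact this

/-- A Kemeny median of a perturbed law is almost optimal. -/
lemma IsKemenyMedian.medianRisk_le {Q Q' : Measure (Ranking n)} [IsProbabilityMeasure Q]
    [IsProbabilityMeasure Q'] {η : ℝ} {σ : Ranking n} (hσ : IsKemenyMedian Q' σ)
    (h : ∀ p ∈ itemPairs n, |pairProb Q' p.1 p.2 - pairProb Q p.1 p.2| ≤ η) (τ : Ranking n) :
    medianRisk Q σ ≤ medianRisk Q τ + 2 * ((itemPairs n).card * η) := by
  have h1 := abs_le.1 (abs_medianRisk_sub_le h σ)
  have h2 := abs_le.1 (abs_medianRisk_sub_le h τ)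
  have h3 := hσ τ
  linarith [h1.1, h2.2]

/-- A law close to a strictly stochastically transitive law with a margin is strictly
stochastically transitive. -/
lemma StrictlyTransitive.of_close {Q Q' : Measure (Ranking n)} [IsProbabilityMeasure Q']
    (hQ : StrictlyTransitive Q) {η H : ℝ} (hη : η < H)
    (hH : ∀ i j : Fin n, i < j → H ≤ |pairProb Q i j - 1 / 2|)
    (h : ∀ p ∈ itemPairs n, |pairProb Q' p.1 p.2 - pairProb Q p.1 p.2| ≤ η) :
    StrictlyTransitive Q' := by
  have := hQ.isProbability
  have key : ∀ i j : Fin n, i ≠ j → |pairProb Q' i j - pairProb Q i j| ≤ η ∧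
      H ≤ |pairProb Q i j - 1 / 2| := by
    intro i j hij
    rcases lt_or_gt_of_ne hij with h' | h'
    · exact ⟨h (i, j) (by simpa [itemPairs] using h'), hH i j h'⟩
    · have h1 := h (j, i) (by simpa [itemPairs] using h')
      have h2 := hH j i h'
      rw [pairProb_swap Q' h'.ne, pairProb_swap Q h'.ne]
      refine ⟨by rwa [sub_sub_sub_cancel_left, abs_sub_comm], ?_⟩
      rw [abs_sub_comm] at h2
      convert h2 using 2
      ring
  refine ⟨inferInstance, fun i j k hij hjk hik h1 h2 => ?_, fun i j hij h0 => ?_⟩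
  -- A perturbation smaller than the margin cannot cross `1/2`.
  · have up : ∀ i j : Fin n, i ≠ j → 1 / 2 ≤ pairProb Q' i j → 1 / 2 ≤ pairProb Q i j := by
      intro i j hij hp
      obtain ⟨ha, hb⟩ := key i j hij
      by_contra! hc
      rw [abs_of_nonpos (by linarith)] at hb
      linarith [(abs_le.1 ha).2]
    have h3 := hQ.transitive i j k hij hjk hik (up i j hij h1) (up j k hjk h2)
    obtain ⟨ha, hb⟩ := key i k hik
    rw [abs_of_nonneg (by linarith)] at hb
    linarith [(abs_le.1 ha).1]
  · obtain ⟨ha, hb⟩ := key i j hij.ne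
    rw [h0, abs_sub_comm] at ha
    linarith

end Rankings

/-! ### The empirical law on a cell -/

section EmpiricalLaw

variable {α : Type*} {n N : ℕ}

lemma isProbabilityMeasure_empiricalLaw {D : Sample α n N} {C : Set α}
    (h : (inCell D C).Nonempty) : IsProbabilityMeasure (empiricalLaw D C) := by
  refine ⟨?_⟩
  have h0 : ((inCell D C).card : ℝ≥0∞) ≠ 0 := by exact_mod_cast h.card_pos.ne'
  simp [empiricalLaw, ENNReal.inv_mul_cancel h0]

open Classical in
lemma empFreq_prod (D : Sample α n N) (C : Set α) (S : Set (Ranking n)) :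
    empFreq D (C ×ˢ S) = ((inCell D C).filter fun k => (D k).2 ∈ S).card / N := by
  rw [empFreq, inCell, Finset.filter_filter, Finset.card_filter]
  push_cast
  congr!

lemma empFreq_prod_univ (D : Sample α n N) (C : Set α) :
    empFreq D (C ×ˢ (Set.univ : Set (Ranking n))) = (inCell D C).card / N := by
  simp [empFreq_prod]

/-- This quotient form reduces accuracy on a cell to deviations of frequencies. On an empty cell
both sides are `0`. -/
lemma empiricalLaw_real (D : Sample α n N) (C : Set α) (S : Set (Ranking n)) (hN : N ≠ 0) :
    (empiricalLaw D C).real S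
      = empFreq D (C ×ˢ S) / empFreq D (C ×ˢ (Set.univ : Set (Ranking n))) := by
  classical
  have hS : MeasurableSet S := trivial
  rw [empFreq_prod, empFreq_prod_univ, div_div_div_cancel_right₀ (by exact_mod_cast hN),
    Measure.real, empiricalLaw]
  simp only [Measure.smul_apply, Measure.coe_finsetSum, Finset.sum_apply, smul_eq_mul,
    Measure.dirac_apply' _ hS, Set.indicator_apply, Pi.one_apply, Finset.sum_ite,
    Finset.sum_const_zero, add_zero, Finset.sum_const, nsmul_eq_mul, mul_one, ENNReal.toReal_mul,
    ENNReal.toReal_inv, ENNReal.toReal_natCast]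
  ring

variable [MeasurableSpace α]

/-- If the empirical frequencies on a cell of large enough mass are accurate, and the conditional
law varies little on that cell, then the empirical law on the cell approximates the conditional
laws. -/
lemma abs_empiricalLaw_real_sub_le {μ : Measure α} [IsProbabilityMeasure μ]
    {P : Kernel α (Ranking n)} [IsMarkovKernel P] {D : Sample α n N} {C : Set α}
    (hC : MeasurableSet C) (hN : N ≠ 0) {t r b : ℝ} (hμ : 0 < μ.real C)
    (hdev : ∀ S : Set (Ranking n), |empFreq D (C ×ˢ S) - (μ ⊗ₘ P).real (C ×ˢ S)| ≤ t)
    (ht : t ≤ r / 2 * μ.real C) (hr : r < 1) :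
    (inCell D C).Nonempty ∧ ∀ S : Set (Ranking n), ∀ x ∈ C,
      (∀ y ∈ C, |(P y).real S - (P x).real S| ≤ b) →
      |(empiricalLaw D C).real S - (P x).real S| ≤ r + b := by
  have hN' : (0 : ℝ) < N := by positivity
  have hQ : ∀ S : Set (Ranking n), (μ ⊗ₘ P).real (C ×ˢ S) = ∫ y in C, (P y).real S ∂μ := by
    intro S
    rw [Measure.real, Measure.compProd_apply_prod hC (show MeasurableSet S from trivial)]
    exact (integral_toReal (P.measurable_coe trivial).aemeasurable
      (ae_of_all _ fun y => measure_lt_top _ _)).symm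
  set m := μ.real C with hm
  set c := empFreq D (C ×ˢ (Set.univ : Set (Ranking n))) with hc
  have hcm : |c - m| ≤ t := by
    have := hdev Set.univ
    rwa [hQ, show ∫ y in C, (P y).real Set.univ ∂μ = m by simp [hm]] at this
  -- As `r < 1`, the deviation `t` is smaller than `m`.
  have hcpos : 0 < c := by
    have := (abs_le.1 hcm).1
    nlinarith
  refine ⟨?_, fun S x hx hb => ?_⟩
  · rw [hc, empFreq_prod_univ] at hcpos
    by_contra h
    rw [Finset.not_nonempty_iff_eq_empty] at h
    simp [h] at hcpos
  rw [empiricalLaw_real D C S hN, ← hc]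
  set a := empFreq D (C ×ˢ S) with ha
  set q := (μ ⊗ₘ P).real (C ×ˢ S) with hq
  set p := (P x).real S
  have haq : |a - q| ≤ t := hdev S
  have ha0 : 0 ≤ a := by
    rw [ha, empFreq_prod]
    positivity
  have hac : a ≤ c := by
    classical
    rw [ha, hc, empFreq_prod, empFreq_prod_univ]
    gcongr
    exact Finset.filter_subset _ _
  have hqp : |q - m * p| ≤ b * m := by
    have hint : IntegrableOn (fun y => (P y).real S) C μ := by
      refine Integrable.integrableOn (Integrable.of_bound
        (P.measurable_coe trivial).ennreal_toReal.aestronglyMeasurable 1 (ae_of_all _ fun y => ?_))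
      rw [Real.norm_eq_abs]
      exact (abs_of_nonneg measureReal_nonneg).trans_le measureReal_le_one
    have : q - m * p = ∫ y in C, ((P y).real S - p) ∂μ := by
      rw [integral_sub hint (integrableOn_const (measure_ne_top _ _)), ← hQ, setIntegral_const,
        smul_eq_mul]
    rw [this, ← Real.norm_eq_abs]
    exact norm_setIntegral_le_of_norm_le_const (measure_lt_top _ _) hb
  -- The chain `a / c`, `a / m`, `q / m`, `p` costs `t / m`, `t / m` and `b`; the first step uses `a
  -- ≤ c`.
  have e1 : |a / c - a / m| ≤ t / m := by
    have : a / c - a / m = a / c * ((m - c) / m) := by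
      field_simp
    rw [this, abs_mul, abs_div (m - c), abs_of_pos hμ, abs_sub_comm, abs_of_nonneg (by positivity)]
    calc a / c * (|c - m| / m) ≤ 1 * (t / m) := by
          gcongr
          exact div_le_one_of_le₀ hac hcpos.le
      _ = _ := one_mul _
  have e2 : |a / m - q / m| ≤ t / m := by
    rw [← sub_div, abs_div, abs_of_pos hμ]
    gcongr
  have e3 : |q / m - p| ≤ b := by
    have : q / m - p = (q - m * p) / m := by
      field_simp
    rw [this, abs_div, abs_of_pos hμ, div_le_iff₀ hμ]
    exact hqp
  have e4 : t / m ≤ r / 2 := (div_le_iff₀ hμ).2 ht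
  rw [abs_le] at *
  constructor <;> linarith [e1.1, e1.2, e2.1, e2.2, e3.1, e3.2]

end EmpiricalLaw

/-! ### Data-dependent partitions -/

section Partition

variable {α : Type*} {n N : ℕ}

/-- The supremum in `ℕ` is a genuine one: the subsets of `Fin N` bound the family. -/
lemma ncard_traces_le_shatterCoeff (𝒜 : Set (Set α)) (x : Fin N → α) :
    {T : Set (Fin N) | ∃ A ∈ 𝒜, T = x ⁻¹' A}.ncard ≤ shatterCoeff 𝒜 N := by
  refine le_ciSup (f := fun x : Fin N → α => {T : Set (Fin N) | ∃ A ∈ 𝒜, T = x ⁻¹' A}.ncard)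
    ⟨(Set.univ : Set (Set (Fin N))).ncard, ?_⟩ x
  rintro _ ⟨y, rfl⟩
  exact Set.ncard_le_ncard (Set.subset_univ _) Set.finite_univ

/-- The trace of `C ×ˢ S` is that of `C` cut by a fixed set of indices. -/
lemma ncard_traces_prod_le_shatterCoeff (𝒜 : Set (Set α)) (S : Set (Ranking n))
    (z : Fin N → α × Ranking n) :
    {T : Set (Fin N) | ∃ A ∈ {B | ∃ C ∈ 𝒜, B = C ×ˢ S}, T = z ⁻¹' A}.ncard
      ≤ shatterCoeff 𝒜 N := by
  refine le_trans ?_ (ncard_traces_le_shatterCoeff 𝒜 fun k => (z k).1)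
  refine le_trans (Set.ncard_le_ncard ?_ (Set.toFinite _))
    (Set.ncard_image_le (f := fun T => T ∩ {k | (z k).2 ∈ S}) (Set.toFinite _))
  rintro _ ⟨_, ⟨C, hC, rfl⟩, rfl⟩
  exact ⟨_, ⟨C, hC, rfl⟩, rfl⟩

variable [MeasurableSpace α]

lemma BorelPartition.eq_of_mem (𝒬 : BorelPartition α) {C C' : Set α} (hC : C ∈ 𝒬.cells)
    (hC' : C' ∈ 𝒬.cells) {x : α} (hx : x ∈ C) (hx' : x ∈ C') : C = C' :=
  (𝒬.isPartition.2 x).unique ⟨hC, hx⟩ ⟨hC', hx'⟩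

lemma BorelPartition.exists_mem (𝒬 : BorelPartition α) (x : α) : ∃ C ∈ 𝒬.cells, x ∈ C :=
  (𝒬.isPartition.2 x).exists

lemma BorelPartition.sameCell_eq (𝒬 : BorelPartition α) {C : Set α} (hC : C ∈ 𝒬.cells) {x : α}
    (hx : x ∈ C) : {y | ∃ C ∈ 𝒬.cells, x ∈ C ∧ y ∈ C} = C := by
  ext y
  exact ⟨fun ⟨C', hC', h1, h2⟩ => 𝒬.eq_of_mem hC' hC h1 hx ▸ h2, fun hy => ⟨C, hC, hx, hy⟩⟩

lemma BorelPartition.minMass_le (𝒬 : BorelPartition α) (μ : Measure α) {C : Set α}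
    (hC : C ∈ 𝒬.cells) : 𝒬.minMass μ ≤ μ C :=
  iInf₂_le C hC

lemma BorelPartition.measurable_of_const (𝒬 : BorelPartition α) {β : Type*} [MeasurableSpace β]
    {s : α → β} (hs : ∀ C ∈ 𝒬.cells, ∃ σ, ∀ x ∈ C, s x = σ) : Measurable s := by
  intro T _
  have : s ⁻¹' T = ⋃ C ∈ {C ∈ 𝒬.cells | C ⊆ s ⁻¹' T}, C := by
    ext x
    simp only [Set.mem_preimage, Set.mem_iUnion, exists_prop]
    constructor
    · intro hx
      obtain ⟨C, hC, hxC⟩ := 𝒬.exists_mem x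
      obtain ⟨σ, hσ⟩ := hs C hC
      refine ⟨C, ⟨hC, fun y hy => ?_⟩, hxC⟩
      rw [Set.mem_preimage, hσ y hy, ← hσ x hxC]
      exact hx
    · rintro ⟨C, ⟨_, hC⟩, hx⟩
      exact hC hx
  rw [this]
  exact (𝒬.finite.subset (Set.sep_subset _ _)).measurableSet_biUnion
    fun C hC => 𝒬.measurable C hC.1

/-- Compactness bounds the cells and finiteness bounds their diameters, so neither `Metric.diam` nor
`⨆` takes its default value. -/
lemma BorelPartition.dist_le_maxDiam {α : Type*} [PseudoMetricSpace α] [CompactSpace α]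
    [MeasurableSpace α] (𝒬 : BorelPartition α) {C : Set α} (hC : C ∈ 𝒬.cells) {x y : α}
    (hx : x ∈ C) (hy : y ∈ C) : dist x y ≤ 𝒬.maxDiam := by
  have := 𝒬.finite.to_subtype
  exact (Metric.dist_le_diam_of_mem Metric.isBounded_of_compactSpace hx hy).trans
    (le_ciSup (f := fun C : 𝒬.cells => Metric.diam (C : Set α)) (Set.finite_range _).bddAbove
      ⟨C, hC⟩)

/-- The unions of cells pick out at least the empty set and the whole sample. -/
lemma PartitioningRule.two_le_shatter (π : PartitioningRule α n N) (hN : N ≠ 0) [Nonempty α] :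
    2 ≤ π.shatter := by
  obtain ⟨x₀⟩ := ‹Nonempty α›
  refine le_trans ?_ (ncard_traces_le_shatterCoeff
    (unionsOfCells (Set.range π.toFun)) fun _ : Fin N => x₀)
  have hne : (∅ : Set (Fin N)) ≠ Set.univ := by
    have : Nonempty (Fin N) := ⟨⟨0, Nat.pos_of_ne_zero hN⟩⟩
    exact Set.empty_ne_univ
  rw [← Set.ncard_pair hne]
  refine Set.ncard_le_ncard ?_ (Set.toFinite _)
  set 𝒬 := π.toFun fun _ => (x₀, 1)
  rintro T (rfl | rfl)
  · exact ⟨∅, ⟨𝒬, ⟨_, rfl⟩, ∅, Set.empty_subset _, by simp⟩, by simp⟩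
  · refine ⟨Set.univ, ⟨𝒬, ⟨_, rfl⟩, 𝒬.cells, subset_rfl, ?_⟩, by simp⟩
    exact 𝒬.isPartition.sUnion_eq_univ.symm

/-- Uniform deviation inequality over the cells of the data-dependent partition. -/
theorem PartitioningRule.measure_exists_lt_abs_empFreq_sub_le (π : PartitioningRule α n N)
    (μ : Measure α) [IsProbabilityMeasure μ] (P : Kernel α (Ranking n)) [IsMarkovKernel P]
    {t : ℝ} (ht : 0 < t) (hNt : 2 ≤ N * t ^ 2) :
    (Measure.pi fun _ : Fin N => μ ⊗ₘ P) {D | ∃ S : Set (Ranking n), ∃ C ∈ (π.toFun D).cells,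
      t < |empFreq D (C ×ˢ S) - (μ ⊗ₘ P).real (C ×ˢ S)| ∧ μ C ≠ 0}
      ≤ Fintype.card (Set (Ranking n)) *
        ENNReal.ofReal (8 * π.shatter * Real.exp (-(N * t ^ 2 / 32))) := by
  classical
  set R := {q : Sample α n N × (α × α) | ∃ C ∈ (π.toFun q.1).cells, q.2.1 ∈ C ∧ q.2.2 ∈ C}
  -- A point `x` serves as the index of its cell, so a cell of positive mass is selected by a
  -- non-null set of indices.
  set W : Set (Ranking n) → Set (Sample α n N × (α × (α × Ranking n))) :=
    fun S => {w | (w.1, (w.2.1, w.2.2.1)) ∈ R ∧ w.2.2.2 ∈ S}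
  have hW : ∀ S, MeasurableSet (W S) := by
    intro S
    have hS : MeasurableSet S := trivial
    exact (measurableSet_preimage (by fun_prop) π.measurable_sameCell).inter
      (measurableSet_preimage (by fun_prop) hS)
  have hslice : ∀ S D, ∀ C ∈ (π.toFun D).cells, ∀ x ∈ C, {z | (D, (x, z)) ∈ W S} = C ×ˢ S := by
    intro S D C hC x hx
    conv_rhs => rw [← (π.toFun D).sameCell_eq hC hx]
    rfl
  have hS := fun S : Set (Ranking n) => RankingMedian.measure_exists_lt_abs_empFreq_sub_le
    (μ ⊗ₘ P) μ (hW S) (𝒜 := {B | ∃ C ∈ unionsOfCells (Set.range π.toFun), B = C ×ˢ S})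
    (fun D x => by
      obtain ⟨C, hC, hx⟩ := (π.toFun D).exists_mem x
      exact ⟨C, ⟨_, ⟨D, rfl⟩, {C}, by simpa using hC, by simp⟩, hslice S D C hC x hx⟩)
    (ncard_traces_prod_le_shatterCoeff _ S) ht hNt
  refine (measure_mono (t := ⋃ S : Set (Ranking n), _) ?_).trans
    ((measure_iUnion_fintype_le _ _).trans ((Finset.sum_le_sum fun S _ => hS S).trans ?_))
  · rintro D ⟨S, C, hC, hlt, hμ⟩
    refine Set.mem_iUnion.2 ⟨S, C ×ˢ S, hlt, fun h0 => hμ (measure_mono_null (fun x hx => ?_) h0)⟩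
    exact hslice S D C hC x hx
  · simp only [Finset.sum_const, nsmul_eq_mul]
    rfl

end Partition

/-! ### From local accuracy to small regret -/

section Regret

variable {α : Type*} [MeasurableSpace α] {n : ℕ}

lemma measurable_medianRisk (P : Kernel α (Ranking n)) [IsMarkovKernel P] {s : α → Ranking n}
    (hs : Measurable s) : Measurable fun x => medianRisk (P x) (s x) := by
  have hp : ∀ i j : Fin n, Measurable fun x => pairProb (P x) i j := fun i j =>
    (P.measurable_coe (show MeasurableSet {σ : Ranking n | σ i < σ j} from trivial)).ennreal_toReal
  simp only [medianRisk_eq_sum]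
  refine Finset.measurable_sum _ fun p _ => Measurable.ite ?_ (measurable_const.sub (hp _ _))
    (hp _ _)
  exact measurableSet_preimage hs (show MeasurableSet {σ : Ranking n | σ p.1 < σ p.2} from trivial)

lemma integrable_medianRisk (μ : Measure α) [IsProbabilityMeasure μ] (P : Kernel α (Ranking n))
    [IsMarkovKernel P] {s : α → Ranking n} (hs : Measurable s) :
    Integrable (fun x => medianRisk (P x) (s x)) μ :=
  Integrable.of_bound (measurable_medianRisk P hs).aestronglyMeasurable (itemPairs n).card
    (ae_of_all _ fun _ => abs_medianRisk_le _ _)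

/-- A measurable rule that is pointwise almost optimal is almost optimal. -/
lemma abs_risk_sub_optimalRisk_le (μ : Measure α) [IsProbabilityMeasure μ]
    (P : Kernel α (Ranking n)) [IsMarkovKernel P] {s : α → Ranking n} (hs : Measurable s) {b : ℝ}
    (h : ∀ x τ, medianRisk (P x) (s x) ≤ medianRisk (P x) τ + b) :
    |risk μ P s - optimalRisk μ P| ≤ b := by
  have hbdd : BddBelow (Set.range fun s : {s : α → Ranking n // Measurable s} => risk μ P s.1) := by
    refine ⟨0, ?_⟩
    rintro _ ⟨s', rfl⟩
    exact integral_nonneg fun _ => medianRisk_nonneg _ _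
  have h1 : optimalRisk μ P ≤ risk μ P s := ciInf_le hbdd ⟨s, hs⟩
  have h2 : risk μ P s - b ≤ optimalRisk μ P := by
    have : Nonempty {s : α → Ranking n // Measurable s} := ⟨⟨s, hs⟩⟩
    refine le_ciInf fun s' => ?_
    have := integral_mono (integrable_medianRisk μ P hs)
      ((integrable_medianRisk μ P s'.2).add (integrable_const b)) fun x => h x (s'.1 x)
    simp only [Pi.add_apply] at this
    rw [integral_add (integrable_medianRisk μ P s'.2) (integrable_const b)] at this
    simp only [integral_const, probReal_univ, one_smul] at this
    simp only [risk]
    linarith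
  rw [abs_of_nonneg (by linarith)]
  linarith

/-- On every cell, which has positive mass and contains a sample point, the empirical pairwise
probabilities are within `η` of the conditional ones. -/
def LocallyAccurate {N : ℕ} (μ : Measure α) (P : Kernel α (Ranking n)) (𝒬 : BorelPartition α)
    (D : Sample α n N) (η : ℝ) : Prop :=
  ∀ C ∈ 𝒬.cells, μ C ≠ 0 ∧ (inCell D C).Nonempty ∧ ∀ x ∈ C, ∀ p ∈ itemPairs n,
    |pairProb (empiricalLaw D C) p.1 p.2 - pairProb (P x) p.1 p.2| ≤ η

lemma IsLocalMedianRule.abs_risk_sub_optimalRisk_le {N : ℕ} {μ : Measure α}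
    [IsProbabilityMeasure μ] {P : Kernel α (Ranking n)} [IsMarkovKernel P] {𝒬 : BorelPartition α}
    {D : Sample α n N} {η : ℝ} (h : LocallyAccurate μ P 𝒬 D η) {s : α → Ranking n}
    (hs : IsLocalMedianRule μ 𝒬 D s) :
    |risk μ P s - optimalRisk μ P| ≤ 2 * ((itemPairs n).card * η) := by
  refine RankingMedian.abs_risk_sub_optimalRisk_le μ P
    (𝒬.measurable_of_const fun C hC => (hs C hC).imp fun _ h => h.1) fun x τ => ?_
  obtain ⟨C, hC, hx⟩ := 𝒬.exists_mem x
  obtain ⟨hμ, hne, hacc⟩ := h C hC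
  obtain ⟨σ, hσ, hmed⟩ := hs C hC
  have := isProbabilityMeasure_empiricalLaw hne
  rw [hσ x hx]
  exact (hmed hμ).medianRisk_le (hacc x hx) τ

/-- Closeness to a single `P x` with `x` in the cell puts the empirical law in `𝒯`, so the Borda
alternative never occurs. -/
lemma IsLocalPseudoMedianRule.isLocalMedianRule {N : ℕ} {μ : Measure α} {P : Kernel α (Ranking n)}
    {𝒬 : BorelPartition α} {D : Sample α n N} {η H : ℝ} (h : LocallyAccurate μ P 𝒬 D η)
    (hT : ∀ x, StrictlyTransitive (P x)) (hη : η < H)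
    (hH : ∀ x, ∀ i j : Fin n, i < j → H ≤ |pairProb (P x) i j - 1 / 2|)
    {s : α → Ranking n} (hs : IsLocalPseudoMedianRule μ 𝒬 D s) :
    IsLocalMedianRule μ 𝒬 D s := by
  intro C hC
  obtain ⟨hμ, hne, hacc⟩ := h C hC
  obtain ⟨x, hx⟩ := nonempty_of_measure_ne_zero hμ
  obtain ⟨σ, hσ, hmed⟩ := hs C hC
  have := isProbabilityMeasure_empiricalLaw hne
  exact ⟨σ, hσ, fun hμ => (hmed hμ).1 ((hT x).of_close hη (hH x) (hacc x hx))⟩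

end Regret

/-! ### Transfer to the observed sample -/

section Observations

variable {α : Type*} [MeasurableSpace α] {n : ℕ} {μ : Measure α} {P : Kernel α (Ranking n)}
  {Ω : Type*} [MeasurableSpace Ω] {Pr : Measure Ω} {Z : ℕ → Ω → α × Ranking n}

/-- Only an inequality, because `B` need not be measurable. -/
lemma measure_firstObs_le [IsProbabilityMeasure Pr] (hZ_meas : ∀ k, Measurable (Z k)) (hZ_indep : iIndepFun Z Pr)
    (hZ_law : ∀ k, Measure.map (Z k) Pr = μ ⊗ₘ P) (N : ℕ) (B : Set (Sample α n N)) :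
    Pr (firstObs Z N ⁻¹' B) ≤ (Measure.pi fun _ : Fin N => μ ⊗ₘ P) B := by
  have hm : AEMeasurable (firstObs Z N) Pr :=
    (show Measurable (firstObs Z N) from
      measurable_pi_lambda _ fun k => hZ_meas k).aemeasurable
  have h := (iIndepFun_iff_map_fun_eq_pi_map (f := fun (k : Fin N) ω => Z k ω)
    fun k => (hZ_meas k).aemeasurable).1 (hZ_indep.precomp Fin.val_injective)
  simp only [hZ_law] at h
  rw [← h]
  exact Measure.le_map_apply hm B

/-- Local accuracy with high probability implies the consistency of the local median rules. -/
lemma consistent_of_tendsto_measure_not_locallyAccurate [IsProbabilityMeasure μ]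
    [IsMarkovKernel P] {𝒬 : ℕ → Ω → BorelPartition α}
    (h : ∀ η : ℝ, 0 < η → η < 1 → Tendsto (fun N => Pr {ω | ¬ LocallyAccurate μ P (𝒬 N ω)
      (firstObs Z N ω) η}) atTop (𝓝 0)) {s : ℕ → Ω → α → Ranking n} {H : ℝ} (hH : 0 < H)
    (hs : ∀ η < H, ∀ N ω, LocallyAccurate μ P (𝒬 N ω) (firstObs Z N ω) η →
      IsLocalMedianRule μ (𝒬 N ω) (firstObs Z N ω) (s N ω)) :
    Consistent Pr μ P s := by
  refine tendstoInMeasure_iff_dist.2 fun e he => ?_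
  set c : ℝ := ((itemPairs n).card : ℝ)
  have hc : 0 ≤ c := Nat.cast_nonneg _
  -- The last term keeps the regret `2 * (c * η)` strictly below `e`.
  set η := min (min (1 / 2) (H / 2)) (e / (4 * (c + 1)))
  have hη0 : 0 < η := by positivity
  have hη1 : η < 1 := lt_of_le_of_lt ((min_le_left _ _).trans (min_le_left _ _)) (by norm_num)
  have hηH : η < H := lt_of_le_of_lt ((min_le_left _ _).trans (min_le_right _ _)) (by linarith)
  have hηe : η ≤ e / (4 * (c + 1)) := min_le_right _ _
  rw [le_div_iff₀ (by positivity)] at hηe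
  refine tendsto_of_tendsto_of_tendsto_of_le_of_le tendsto_const_nhds (h η hη0 hη1)
    (fun _ => zero_le) fun N => measure_mono fun ω hω hacc => ?_
  have h1 := (hs η hηH N ω hacc).abs_risk_sub_optimalRisk_le hacc
  simp only [Set.mem_ofPred_eq, Real.dist_eq] at hω
  have h2 : e ≤ 2 * (c * η) := hω.trans h1
  nlinarith

end Observations

/-! ### Local accuracy with high probability -/

section Consistency

/-- The bound is a multiple of `Δ ^ (1 - K ^ 2 / 32)`. For `K ≥ 8` the exponent is negative, so `Δ =
2` is the worst case, and there the bound vanishes as `K → ∞`. One `K` thus serves all `N`. -/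
lemma exists_exponent {τ : ℝ≥0∞} (hτ : 0 < τ) (c : ℕ) : ∃ K : ℝ, 8 ≤ K ∧ ∀ Δ : ℕ, 2 ≤ Δ →
    c * ENNReal.ofReal (8 * Δ * Real.exp (-(K ^ 2 * Real.log Δ / 32))) ≤ τ := by
  have hlim : Tendsto (fun K : ℝ => c * ENNReal.ofReal
      (8 * Real.exp (Real.log 2 * (1 - K ^ 2 / 32)))) atTop (𝓝 (c * ENNReal.ofReal (8 * 0))) := by
    refine ENNReal.Tendsto.const_mul (ENNReal.tendsto_ofReal (Tendsto.const_mul _ ?_))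
      (Or.inr (ENNReal.natCast_ne_top c))
    refine Real.tendsto_exp_atBot.comp (Tendsto.const_mul_atBot (Real.log_pos one_lt_two) ?_)
    have : Tendsto (fun K : ℝ => K ^ 2 / 32) atTop atTop :=
      (tendsto_pow_atTop two_ne_zero).atTop_div_const (by norm_num)
    exact tendsto_const_nhds.add_atBot (tendsto_neg_atTop_atBot.comp this)
  rw [mul_zero, ENNReal.ofReal_zero, mul_zero] at hlim
  obtain ⟨K, hK, hK8⟩ := ((ENNReal.tendsto_nhds_zero.1 hlim τ hτ).and (eventually_ge_atTop 8)).exists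
  refine ⟨K, hK8, fun Δ hΔ => le_trans ?_ hK⟩
  have hΔ0 : (0 : ℝ) < Δ := by positivity
  have hlog : Real.log 2 ≤ Real.log Δ := Real.log_le_log two_pos (by exact_mod_cast hΔ)
  have hexp : 8 * Δ * Real.exp (-(K ^ 2 * Real.log Δ / 32))
      = 8 * Real.exp (Real.log Δ * (1 - K ^ 2 / 32)) := by
    rw [show Real.log Δ * (1 - K ^ 2 / 32) = Real.log Δ + -(K ^ 2 * Real.log Δ / 32) by ring,
      Real.exp_add, Real.exp_log hΔ0, mul_assoc]
  rw [hexp]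
  have : 1 - K ^ 2 / 32 ≤ 0 := by nlinarith
  have := mul_le_mul_of_nonpos_right hlog this
  gcongr

variable {α : Type*} [PseudoMetricSpace α] [CompactSpace α] [MeasurableSpace α] {n : ℕ}
  {μ : Measure α} [IsProbabilityMeasure μ] {P : Kernel α (Ranking n)} [IsMarkovKernel P]

/-- The conditions on the diameter, on the mass of the cells, and on the empirical frequencies that
imply local accuracy. -/
lemma locallyAccurate_of_deviation {N : ℕ} (hN : N ≠ 0) {𝒬 : BorelPartition α} {D : Sample α n N}
    {η M K L : ℝ} (hη : 0 < η) (hη1 : η < 1) (hK : 0 < K) (hL : 0 < L)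
    (hM : ∀ x x' : α, ∑ p ∈ itemPairs n, |pairProb (P x) p.1 p.2 - pairProb (P x') p.1 p.2|
      ≤ M * dist x x')
    (hdiam : 𝒬.maxDiam ≤ η / (2 * (|M| + 1)))
    (hmass : (𝒬.minMass μ)⁻¹ ≤ ENNReal.ofReal (η / (4 * K) * √(N / L)))
    (hdev : ∀ S : Set (Ranking n), ∀ C ∈ 𝒬.cells, μ C ≠ 0 →
      |empFreq D (C ×ˢ S) - (μ ⊗ₘ P).real (C ×ˢ S)| ≤ K * √(L / N)) :
    LocallyAccurate μ P 𝒬 D η := by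
  intro C hC
  have hN' : (0 : ℝ) < N := by positivity
  have hinv : (μ C)⁻¹ ≤ ENNReal.ofReal (η / (4 * K) * √(N / L)) :=
    (ENNReal.inv_le_inv.2 (𝒬.minMass_le μ hC)).trans hmass
  -- A null cell would make the inverse mass infinite.
  have hμ : μ C ≠ 0 := by
    intro h0
    rw [h0, ENNReal.inv_zero] at hinv
    exact ENNReal.ofReal_ne_top (top_le_iff.1 hinv)
  have hμr : 0 < μ.real C := ENNReal.toReal_pos hμ (measure_ne_top _ _)
  have hinv' : (μ.real C)⁻¹ ≤ η / (4 * K) * √(N / L) := by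
    rw [Measure.real, ← ENNReal.toReal_inv]
    exact ENNReal.toReal_le_of_le_ofReal (by positivity) hinv
  have hone : 1 ≤ η / (4 * K) * √(N / L) * μ.real C := by
    rwa [inv_le_iff_one_le_mul₀ hμr] at hinv'
  have hsq : √(L / N) * √(N / L) = 1 := by
    rw [← Real.sqrt_mul (by positivity), div_mul_div_cancel₀ hN'.ne', div_self hL.ne', Real.sqrt_one]
  have ht : K * √(L / N) ≤ η / 2 / 2 * μ.real C := by
    calc K * √(L / N) = K * √(L / N) * 1 := (mul_one _).symm
      _ ≤ K * √(L / N) * (η / (4 * K) * √(N / L) * μ.real C) := by gcongr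
      _ = (√(L / N) * √(N / L)) * (η / 2 / 2 * μ.real C) := by
        field_simp
        ring
      _ = _ := by rw [hsq, one_mul]
  -- The tolerance is split evenly: `r = η / 2` for the random error, `b = η / 2` for the bias.
  obtain ⟨hne, hacc⟩ := abs_empiricalLaw_real_sub_le (b := η / 2) (𝒬.measurable C hC) hN hμr
    (fun S => hdev S C hC hμ) ht (by linarith)
  refine ⟨hμ, hne, fun x hx p hp => ?_⟩
  have := hacc {σ | σ p.1 < σ p.2} x hx fun y hy => ?_
  · rw [add_halves] at this
    exact this
  · have h1 : |pairProb (P y) p.1 p.2 - pairProb (P x) p.1 p.2| ≤ M * dist y x :=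
      (Finset.single_le_sum
        (f := fun p : Fin n × Fin n => |pairProb (P y) p.1 p.2 - pairProb (P x) p.1 p.2|)
        (fun _ _ => abs_nonneg _) hp).trans (hM y x)
    refine h1.trans ?_
    have h2 := (𝒬.dist_le_maxDiam hC hy hx).trans hdiam
    rw [le_div_iff₀ (by positivity)] at h2
    nlinarith [le_abs_self M, dist_nonneg (x := y) (y := x)]

variable {Ω : Type*} [MeasurableSpace Ω] {Pr : Measure Ω} [IsProbabilityMeasure Pr]
  {Z : ℕ → Ω → α × Ranking n}

/-- Accuracy fails only if some cell is too wide, some cell is too light, or some frequency deviates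
too much; each event gets `τ / 3`. Since `K` depends on `τ` but not on `N`, the mass condition can
be used with the constant `η / (4 * K)`. -/
theorem tendsto_measure_not_locallyAccurate
    (hZ_meas : ∀ k, Measurable (Z k)) (hZ_indep : iIndepFun Z Pr)
    (hZ_law : ∀ k, Measure.map (Z k) Pr = μ ⊗ₘ P) (π : ∀ N : ℕ, PartitioningRule α n N)
    (hLip : LipschitzPairProb P)
    (hDiam : TendstoInMeasure Pr
      (fun N ω => ((π N).toFun (firstObs Z N ω)).maxDiam) atTop (fun _ => (0 : ℝ)))
    (hMass : IsLittleOInProb Pr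
      (fun N ω => (((π N).toFun (firstObs Z N ω)).minMass μ)⁻¹)
      (fun N => Real.sqrt ((N : ℝ) / Real.log ((π N).shatter : ℝ))))
    {η : ℝ} (hη : 0 < η) (hη1 : η < 1) :
    Tendsto (fun N => Pr {ω | ¬ LocallyAccurate μ P ((π N).toFun (firstObs Z N ω))
      (firstObs Z N ω) η}) atTop (𝓝 0) := by
  obtain ⟨M, hM⟩ := hLip
  have : Nonempty α := μ.nonempty_of_neZero
  rw [ENNReal.tendsto_nhds_zero]
  intro τ hτ
  obtain ⟨K, hK8, hK⟩ := exists_exponent (ENNReal.div_pos hτ.ne' (by simp : (3 : ℝ≥0∞) ≠ ⊤))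
    (Fintype.card (Set (Ranking n)))
  have hδ : 0 < η / (2 * (|M| + 1)) := by positivity
  have hτ3 : 0 < τ / 3 := ENNReal.div_pos hτ.ne' (by simp)
  filter_upwards [eventually_ne_atTop 0,
    ENNReal.tendsto_nhds_zero.1 (tendstoInMeasure_iff_dist.1 hDiam _ hδ) _ hτ3,
    ENNReal.tendsto_nhds_zero.1 (hMass (η / (4 * K)) (by positivity)) _ hτ3] with N hN h1 h2
  have hN' : (0 : ℝ) < N := by positivity
  have hΔ := (π N).two_le_shatter hN
  set L := Real.log ((π N).shatter : ℝ) with hL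
  have hL2 : Real.log 2 ≤ L := Real.log_le_log two_pos (by exact_mod_cast hΔ)
  have hL0 : 0 < L := (Real.log_pos one_lt_two).trans_le hL2
  set t := K * √(L / N) with ht
  have hNt : N * t ^ 2 = K ^ 2 * L := by
    rw [ht, mul_pow, Real.sq_sqrt (by positivity)]
    field_simp
  have ht0 : 0 < t := by positivity
  -- The Chebyshev step needs `2 ≤ K ^ 2 * L`, which follows from `K ≥ 8` and `L ≥ log 2`.
  have hdev := (π N).measure_exists_lt_abs_empFreq_sub_le μ P ht0 (by
    rw [hNt]
    nlinarith [Real.log_two_gt_d9])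
  rw [hNt] at hdev
  have h3 := ((measure_firstObs_le hZ_meas hZ_indep hZ_law N _).trans hdev).trans (hK _ hΔ)
  rw [← ENNReal.add_thirds τ]
  refine (measure_mono fun ω hω => ?_).trans ((measure_union_le _ _).trans
    (add_le_add ((measure_union_le _ _).trans (add_le_add h1 h2)) h3))
  by_contra hcon
  simp only [Set.mem_union, Set.mem_ofPred_eq, Set.mem_preimage, not_or, not_lt, not_le, not_exists,
    not_and, Real.dist_eq, sub_zero] at hcon
  obtain ⟨⟨ha, hb⟩, hc⟩ := hcon
  refine hω (locallyAccurate_of_deviation hN hη hη1 (by linarith) hL0 hM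
    ((le_abs_self _).trans ha.le) hb fun S C hC hμ => ?_)
  by_contra! hlt
  exact hμ (of_not_not (hc S C hC hlt))

end Consistency

end RankingMedian

theorem theorem12
    {E : Type*} [NormedAddCommGroup E] [NormedSpace ℝ E] [FiniteDimensional ℝ E]
    [MeasurableSpace E] [BorelSpace E]
    (𝒳 : Set E) (h𝒳 : IsCompact 𝒳) (n : ℕ)
    (μ : Measure 𝒳) [IsProbabilityMeasure μ]
    (P : Kernel 𝒳 (RankingMedian.Ranking n)) [IsMarkovKernel P]
    {Ω : Type*} [MeasurableSpace Ω] (Pr : Measure Ω) [IsProbabilityMeasure Pr]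
    (Z : ℕ → Ω → 𝒳 × RankingMedian.Ranking n)
    (hZ_meas : ∀ k, Measurable (Z k))
    (hZ_indep : iIndepFun Z Pr)
    (hZ_law : ∀ k, Measure.map (Z k) Pr = μ ⊗ₘ P)
    (π : ∀ N : ℕ, RankingMedian.PartitioningRule 𝒳 n N)
    (hT : ∀ x, RankingMedian.StrictlyTransitive (P x))
    (hLip : RankingMedian.LipschitzPairProb P)
    (hShatter : Tendsto (fun N : ℕ => Real.log ((π N).shatter : ℝ) / (N : ℝ)) atTop (𝓝 0))
    (hDiam : TendstoInMeasure Pr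
      (fun N ω => ((π N).toFun (RankingMedian.firstObs Z N ω)).maxDiam) atTop (fun _ => (0 : ℝ)))
    (hMass : RankingMedian.IsLittleOInProb Pr
      (fun N ω => (((π N).toFun (RankingMedian.firstObs Z N ω)).minMass μ)⁻¹)
      (fun N => Real.sqrt ((N : ℝ) / Real.log ((π N).shatter : ℝ)))) :
    (∀ s : ℕ → Ω → 𝒳 → RankingMedian.Ranking n,
      (∀ N ω, RankingMedian.IsLocalMedianRule μ
        ((π N).toFun (RankingMedian.firstObs Z N ω)) (RankingMedian.firstObs Z N ω) (s N ω)) →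
      RankingMedian.Consistent Pr μ P s) ∧
    (RankingMedian.UniformLowNoise P →
      ∀ s : ℕ → Ω → 𝒳 → RankingMedian.Ranking n,
        (∀ N ω, RankingMedian.IsLocalPseudoMedianRule μ
          ((π N).toFun (RankingMedian.firstObs Z N ω)) (RankingMedian.firstObs Z N ω) (s N ω)) →
        RankingMedian.Consistent Pr μ P s) := by

  have : CompactSpace 𝒳 := isCompact_iff_compactSpace.1 h𝒳
  have hacc := fun (η : ℝ) (hη : 0 < η) (hη1 : η < 1) =>
    RankingMedian.tendsto_measure_not_locallyAccurate hZ_meas hZ_indep hZ_law π hLip hDiam hMass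
      hη hη1
  refine ⟨fun s hs => ?_, fun ⟨_, H, hH, hnoise⟩ s hs => ?_⟩
  -- Kemeny medians need no margin, so any positive threshold will do.
  · exact RankingMedian.consistent_of_tendsto_measure_not_locallyAccurate hacc one_pos
      fun _ _ N ω _ => hs N ω
  · exact RankingMedian.consistent_of_tendsto_measure_not_locallyAccurate hacc hH
      fun _ hη N ω h => (hs N ω).isLocalMedianRule h hT hη hnoise
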